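/- Let $\psi=\Gamma'/\Gamma$ be the digamma function, let $\zeta$ be the Riemann zeta function, and let the Stieltjes constants $\gamma_n$ ($n\ge 0$) be defined by the Laurent expansion $$\zeta(s)=\frac1{s-1}+\sum_{n=0}^\infty\frac{(-1)^n}{n!}\gamma_n(s-1)^n .$$ For $n\ge 1$ let $$Y_n(x_1,\dots,x_n)=\sum\frac{n!}{k_1!\cdots k_n!}\Big(\frac{x_1}{1!}\Big)^{k_1}\cdots\Big(\frac{x_n}{n!}\Big)^{k_n}$$ be the exponential complete Bell polynomial, where the sum is over all integers $k_1,\dots,k_n\ge 0$ with $k_1+2k_2+\dots+nk_n=n$, and let $Y_0=1$. Put $$\mathbf Y_k(s)=Y_k\big(\psi(2-s)-\psi(s),\,-\psi'(2-s)-\psi'(s),\,\dots,\,(-1)^{k-1}\psi^{(k-1)}(2-s)-\psi^{(k-1)}(s)\big).$$ (a) (de Bruijn's formula.) For all complex $s\ne 1$ with $0<\operatorname{Re}s<2$, $$\zeta(s)=\frac1{s-1}-\frac{\sin(\pi s)}{\pi(s-1)}\int_0^\infty\Big[\psi'(1+u)-\frac1{1+u}\Big]u^{1-s}\,du,$$ where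 the integral converges absolutely. (b) For every integer $m\ge 0$ the integral $\int_0^\infty\big[\psi'(1+u)-\frac1{1+u}\big]\log^m u\,du$ converges absolutely, and for every integer $n\ge 0$ $$\gamma_n=\sum_{k=0}^n\binom nk(-1)^k\,\mathbf Y_k(1)\int_0^\infty\Big[\psi'(1+u)-\frac1{1+u}\Big]\log^{n-k}u\,du ,$$ where, for every integer $k\ge 0$, $\mathbf Y_k(1)=Y_k(x_1,\dots,x_k)$ with $x_1=0$ and $x_j=-[1+(-1)^j]\,\zeta(j)\,(j-1)!$ for $2\le j\le k$. (c) In particular, $$\gamma_1=\int_0^\infty\Big[\psi'(1+u)-\frac1{1+u}\Big]\log u\,du .$$ -/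

import Mathlib

noncomputable section

/-- The `n`-th Stieltjes constant: `(-1) ^ n / n!` times it is the coefficient of `(s - 1) ^ n` in
the Laurent expansion of the Riemann zeta function at `s = 1`. Here `riemannZeta₀` is the entire
function extending `ζ(s) - 1 / (s - 1)`. See `hasSum_stieltjesConst` for the Laurent expansion. -/
def stieltjesConst (n : ℕ) : ℂ := (-1) ^ n * iteratedDeriv n riemannZeta₀ 1

/-- The Laurent expansion of the Riemann zeta function about `s = 1`. -/
theorem hasSum_stieltjesConst {s : ℂ} (hs : s ≠ 1) :
    HasSum (fun n : ℕ => (-1) ^ n / (n.factorial : ℂ) * stieltjesConst n * (s - 1) ^ n)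
      (riemannZeta s - 1 / (s - 1)) := by
  have h := Complex.hasSum_taylorSeries_of_entire differentiable_riemannZeta₀ 1 s
  have e : riemannZeta₀ s = riemannZeta s - 1 / (s - 1) := by simp [riemannZeta₀, hs]
  rw [e] at h
  refine h.congr_fun fun n => ?_
  have h1 : ((-1 : ℂ) ^ n) * (-1) ^ n = 1 := by rw [← mul_pow]; simp
  simp only [stieltjesConst, smul_eq_mul]
  linear_combination ((n.factorial : ℂ)⁻¹ * (s - 1) ^ n * iteratedDeriv n riemannZeta₀ 1) * h1

/-- The (exponential) complete Bell polynomial `Y_n(x_1, …, x_n)`. The sum is over the partitions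
of `n`; `k_j = p.parts.count j` is the number of parts of `p` that are equal to `j`. Only the values
`x 1, …, x n` are used. -/
def completeBell (n : ℕ) (x : ℕ → ℂ) : ℂ :=
  ∑ p : n.Partition,
    (n.factorial : ℂ) / (∏ j ∈ Finset.Icc 1 n, ((p.parts.count j).factorial : ℂ)) *
      ∏ j ∈ Finset.Icc 1 n, (x j / (j.factorial : ℂ)) ^ p.parts.count j

/-- The `j`-th argument `(-1)^(j-1) ψ^(j-1)(2 - s) - ψ^(j-1)(s)`, `j ≥ 1`, of the Bell polynomials
`Y_k(ψ₁(s))`. -/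
def bellArg (s : ℂ) (j : ℕ) : ℂ :=
  (-1) ^ (j - 1) * iteratedDeriv (j - 1) Complex.digamma (2 - s) -
    iteratedDeriv (j - 1) Complex.digamma s

/-- The function `ψ'(1 + u) - 1 / (1 + u)` for real `u`. -/
def trigammaKernel (u : ℝ) : ℂ := deriv Complex.digamma (1 + (u : ℂ)) - 1 / (1 + (u : ℂ))

end

/-! ### Recurrence for complete Bell polynomials -/

section CompleteBell

open Finset

/-! Let K(u) = ψ'(1+u) - 1/(1+u). From ψ'(z) = ∑ 1/(z+k)^2, integrating termwise with Beta integrals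
gives, for 1 < Re s < 2, ∫ u^(1-s) ψ'(1+u) du = Γ(s)Γ(2-s)ζ(s), while 1/(1+u) contributes
Γ(s)Γ(2-s)/(s-1). Hence the Mellin transform of K at 2-s is Γ(s)Γ(2-s)(ζ(s) - 1/(s-1)). Since K =
O((1+u)^(-2)), it is analytic for 0 < Re s < 2, and the identity extends there
(`mellin_trigammaKernel`). Reflection for Γ turns it into de Bruijn's formula.

For γ_n, differentiate ζ(s) - 1/(s-1) = g(s) M(2-s) at s = 1, with g = 1/(Γ(s)Γ(2-s)) and M the
Mellin transform of K. Derivatives of M insert powers of log u. As g' = g·(ψ(2-s) - ψ(s)), Leibniz'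
rule yields exactly the recurrence of the complete Bell polynomials, so g^(k)(1) = Y_k
(`iteratedDeriv_invGammaMulGamma_one`). -/

theorem completeBell_congr {n : ℕ} {x y : ℕ → ℂ} (h : ∀ j, 1 ≤ j → j ≤ n → x j = y j) :
    completeBell n x = completeBell n y := by
  refine sum_congr rfl fun p _ => ?_
  congr 1
  refine prod_congr rfl fun j hj => ?_
  rw [h j (mem_Icc.1 hj).1 (mem_Icc.1 hj).2]

/-- The weight of a multiset of parts in the complete Bell polynomials, normalised without the
factorial of the sum of the parts; only parts up to `N` are taken into account. -/
noncomputable def bellWeight (N : ℕ) (x : ℕ → ℂ) (m : Multiset ℕ) : ℂ :=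
  ∏ j ∈ Icc 1 N, (x j / (j.factorial : ℂ)) ^ m.count j / ((m.count j).factorial : ℂ)

/-- A common cutoff `N` lets weights of partitions of different integers be compared. -/
theorem bellWeight_eq_of_le {n N : ℕ} (h : n ≤ N) (x : ℕ → ℂ) (p : n.Partition) :
    bellWeight N x p.parts = bellWeight n x p.parts := by
  refine (prod_subset (Icc_subset_Icc_right h) fun j _ hj => ?_).symm
  have : p.parts.count j = 0 := Multiset.count_eq_zero.2 fun hm =>
    hj (mem_Icc.2 ⟨p.parts_pos hm, p.le_of_mem_parts hm⟩)
  simp [this]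

theorem completeBell_eq_sum_bellWeight {n N : ℕ} (h : n ≤ N) (x : ℕ → ℂ) :
    completeBell n x = n.factorial * ∑ p : n.Partition, bellWeight N x p.parts := by
  rw [completeBell, mul_sum]
  refine sum_congr rfl fun p _ => ?_
  rw [bellWeight_eq_of_le h, bellWeight, prod_div_distrib]
  ring

theorem bellWeight_cons {N a : ℕ} (ha : a ∈ Icc 1 N) (x : ℕ → ℂ) (m : Multiset ℕ) :
    ((a ::ₘ m).count a : ℂ) * bellWeight N x (a ::ₘ m) =
      x a / (a.factorial : ℂ) * bellWeight N x m := by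
  rw [bellWeight, bellWeight, ← mul_prod_erase _ _ ha, ← mul_prod_erase _ _ ha]
  have h : ∏ j ∈ (Icc 1 N).erase a, (x j / (j.factorial : ℂ)) ^ (a ::ₘ m).count j /
      (((a ::ₘ m).count j).factorial : ℂ) = ∏ j ∈ (Icc 1 N).erase a,
        (x j / (j.factorial : ℂ)) ^ m.count j / ((m.count j).factorial : ℂ) :=
    prod_congr rfl fun j hj => by rw [Multiset.count_cons_of_ne (ne_of_mem_erase hj)]
  rw [h, Multiset.count_cons_self, Nat.factorial_succ]
  have h1 : ((m.count a : ℂ) + 1) ≠ 0 := Nat.cast_add_one_ne_zero _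
  have h2 : ((m.count a).factorial : ℂ) ≠ 0 := Nat.cast_ne_zero.2 (Nat.factorial_ne_zero _)
  push_cast
  field_simp
  rw [pow_succ]
  ring

/-- Removing one part `a` is a bijection from partitions of `n` containing `a` to partitions of `n -
a`; the factor `count a` cancels against the factorial in the weight. -/
theorem sum_count_mul_bellWeight {N n a : ℕ} (h1 : 1 ≤ a) (han : a ≤ n) (hN : n ≤ N)
    (x : ℕ → ℂ) :
    ∑ p : n.Partition, (p.parts.count a : ℂ) * bellWeight N x p.parts =
      x a / (a.factorial : ℂ) * ∑ q : (n - a).Partition, bellWeight N x q.parts := by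
  classical
  have e : ∑ p : n.Partition, (p.parts.count a : ℂ) * bellWeight N x p.parts =
      ∑ p : {p : n.Partition // a ∈ p.parts},
        (p.1.parts.count a : ℂ) * bellWeight N x p.1.parts := by
    rw [← sum_subtype (univ.filter fun p : n.Partition => a ∈ p.parts) (by simp)
      (fun p => (p.parts.count a : ℂ) * bellWeight N x p.parts), sum_filter]
    refine sum_congr rfl fun p _ => ?_
    split_ifs with h
    · rfl
    · simp [Multiset.count_eq_zero.2 h]
  rw [e, mul_sum, ← (Nat.Partition.partitionWithPartEquiv h1 han).symm.sum_comp]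
  refine sum_congr rfl fun q _ => ?_
  rw [Nat.Partition.partitionWithPartEquiv_symm_apply_parts,
    bellWeight_cons (mem_Icc.2 ⟨h1, han.trans hN⟩)]

theorem sum_mul_count_parts {n : ℕ} (p : n.Partition) :
    ∑ j ∈ Icc 1 n, (j : ℂ) * p.parts.count j = n := by
  have h : ∑ j ∈ Icc 1 n, p.parts.count j • j = n := by
    rw [← sum_multiset_count_of_subset _ _ fun j hj => ?_, p.parts_sum]
    have := Multiset.mem_toFinset.1 hj
    exact mem_Icc.2 ⟨p.parts_pos this, p.le_of_mem_parts this⟩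
  calc ∑ j ∈ Icc 1 n, (j : ℂ) * p.parts.count j
      = ((∑ j ∈ Icc 1 n, p.parts.count j • j : ℕ) : ℂ) := by
        push_cast [smul_eq_mul]
        exact sum_congr rfl fun j _ => mul_comm _ _
    _ = n := by rw [h]

@[simp]
theorem completeBell_zero (x : ℕ → ℂ) : completeBell 0 x = 1 := by
  simp [completeBell]

/-- The recurrence of the complete Bell polynomials. -/
theorem completeBell_succ (n : ℕ) (x : ℕ → ℂ) :
    completeBell (n + 1) x =
      ∑ i ∈ range (n + 1), (n.choose i : ℂ) * completeBell i x * x (n - i + 1) := by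
  set S : ℕ → ℂ := fun i => ∑ p : i.Partition, bellWeight (n + 1) x p.parts with hS
  -- Write n + 1 as the sum of the parts, ∑ j · count j, and remove a part j from each term.
  have h1 : ((n + 1 : ℕ) : ℂ) * S (n + 1) =
      ∑ j ∈ Icc 1 (n + 1), (j : ℂ) * (x j / (j.factorial : ℂ) * S (n + 1 - j)) := by
    have h (p : (n + 1).Partition) : ((n + 1 : ℕ) : ℂ) * bellWeight (n + 1) x p.parts =
        ∑ j ∈ Icc 1 (n + 1), (j : ℂ) * p.parts.count j * bellWeight (n + 1) x p.parts := by
      rw [← sum_mul_count_parts p, sum_mul]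
    simp only [hS]
    rw [mul_sum, sum_congr rfl fun p _ => h p, sum_comm]
    refine sum_congr rfl fun j hj => ?_
    rw [← sum_count_mul_bellWeight (mem_Icc.1 hj).1 (mem_Icc.1 hj).2 le_rfl, mul_sum]
    simp only [mul_assoc]
  rw [completeBell_eq_sum_bellWeight le_rfl, Nat.factorial_succ, mul_comm (n + 1), Nat.cast_mul,
    mul_assoc, h1, mul_sum, ← Finset.sum_range_reflect, ← Ico_add_one_right_eq_Icc,
    sum_Ico_eq_sum_range]
  refine sum_congr rfl fun i hi => ?_
  have hi' : i ≤ n := by rw [mem_range] at hi; lia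
  have e1 : n + 1 - 1 - i = n - i := by lia
  have e2 : n + 1 - (1 + i) = n - i := by lia
  have e3 : n - (n - i) = i := by lia
  rw [e1, e2, e3, completeBell_eq_sum_bellWeight (by lia : n - i ≤ n + 1), Nat.choose_symm hi',
    Nat.cast_choose ℂ hi', add_comm 1 i, Nat.factorial_succ]
  have a1 : ((i : ℂ) + 1) ≠ 0 := Nat.cast_add_one_ne_zero _
  have a2 : (i.factorial : ℂ) ≠ 0 := Nat.cast_ne_zero.2 (Nat.factorial_ne_zero _)
  have a3 : ((n - i).factorial : ℂ) ≠ 0 := Nat.cast_ne_zero.2 (Nat.factorial_ne_zero _)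
  push_cast
  simp only [hS]
  field_simp

end CompleteBell

/-! ### Asymptotics of digamma on the positive reals -/

section Stieltjes

open Filter Topology Set MeasureTheory Asymptotics

theorem tendsto_log_add_nat_succ_sub_log {x : ℝ} (hx : 0 < x) :
    Tendsto (fun n : ℕ => Real.log (x + (n + 1 : ℕ)) - Real.log (x + n)) atTop (𝓝 0) := by
  have h1 : Tendsto (fun n : ℕ => 1 + (x + n)⁻¹) atTop (𝓝 (1 + 0)) :=
    tendsto_const_nhds.add (tendsto_inv_atTop_zero.comp
      (tendsto_atTop_add_const_left _ x tendsto_natCast_atTop_atTop))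
  have h2 := (Real.continuousAt_log (by norm_num : (1 + 0 : ℝ) ≠ 0)).tendsto.comp h1
  rw [add_zero, Real.log_one] at h2
  refine h2.congr fun n => ?_
  have : 0 < x + n := by positivity
  rw [Function.comp_apply, ← Real.log_div (by positivity) (by positivity)]
  congr 1
  push_cast
  field_simp
  ring

theorem hasDerivAt_log_Gamma {x : ℝ} (hx : 0 < x) :
    HasDerivAt (Real.log ∘ Real.Gamma) (logDeriv Real.Gamma x) x := by
  have h := (Real.differentiableAt_Gamma (s := x) fun m => by
    have : (0 : ℝ) ≤ m := m.cast_nonneg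
    linarith).hasDerivAt.log (Real.Gamma_pos_of_pos hx).ne'
  simpa [logDeriv_apply, Function.comp_def] using h

/-- By convexity of log Γ, the derivative at x is at most the slope of the chord over [x, x+1],
which is log x because Γ(x+1) = xΓ(x). The next lemma uses the other endpoint. -/
theorem logDeriv_Gamma_le_log {x : ℝ} (hx : 0 < x) : logDeriv Real.Gamma x ≤ Real.log x := by
  have h := Real.convexOn_log_Gamma.le_slope_of_hasDerivAt (mem_Ioi.2 hx)
    (mem_Ioi.2 (by linarith : 0 < x + 1)) (by linarith) (hasDerivAt_log_Gamma hx)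
  have hG := (Real.Gamma_pos_of_pos hx).ne'
  rw [slope_def_field, Function.comp, Function.comp, Real.Gamma_add_one hx.ne',
    Real.log_mul hx.ne' hG] at h
  simpa using h

theorem log_le_logDeriv_Gamma_add_one {x : ℝ} (hx : 0 < x) :
    Real.log x ≤ logDeriv Real.Gamma (x + 1) := by
  have h := Real.convexOn_log_Gamma.slope_le_of_hasDerivAt (mem_Ioi.2 hx)
    (mem_Ioi.2 (by linarith : 0 < x + 1)) (by linarith) (hasDerivAt_log_Gamma (by linarith))
  have hG := (Real.Gamma_pos_of_pos hx).ne'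
  rw [slope_def_field, Function.comp, Function.comp, Real.Gamma_add_one hx.ne',
    Real.log_mul hx.ne' hG] at h
  simpa using h

theorem tendsto_logDeriv_Gamma_sub_log {x : ℝ} (hx : 0 < x) :
    Tendsto (fun n : ℕ => logDeriv Real.Gamma (x + n) - Real.log (x + n)) atTop (𝓝 0) := by
  rw [← tendsto_add_atTop_iff_nat 1]
  have h := (tendsto_log_add_nat_succ_sub_log hx).neg
  rw [neg_zero] at h
  refine tendsto_of_tendsto_of_tendsto_of_le_of_le h tendsto_const_nhds (fun n => ?_) fun n => ?_
  · have := log_le_logDeriv_Gamma_add_one (x := x + n) (by positivity)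
    push_cast
    rw [← add_assoc]
    simp only [neg_sub]
    linarith
  · have := logDeriv_Gamma_le_log (x := x + (n + 1 : ℕ)) (by positivity)
    simp only
    linarith

theorem digamma_ofReal {x : ℝ} (hx : 0 < x) :
    Complex.digamma x = (logDeriv Real.Gamma x : ℝ) := by
  have hm : ∀ m : ℕ, x ≠ -m := fun m => by
    have : (0 : ℝ) ≤ m := m.cast_nonneg
    linarith
  have h1 := (Real.differentiableAt_Gamma hm).hasDerivAt.ofReal_comp
  have h2 := (Complex.differentiableAt_Gamma (x : ℂ) fun m => by
    exact_mod_cast hm m).hasDerivAt.comp_ofReal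
  simp only [Complex.Gamma_ofReal] at h2
  rw [Complex.digamma_def, logDeriv_apply, logDeriv_apply, h2.unique h1, Complex.Gamma_ofReal]
  push_cast
  rfl

theorem digamma_add_nat {z : ℂ} (hz : 0 < z.re) (n : ℕ) :
    Complex.digamma (z + n) = Complex.digamma z + ∑ k ∈ Finset.range n, 1 / (z + k) := by
  induction n with
  | zero => simp
  | succ n ih =>
    rw [Finset.sum_range_succ, ← add_assoc, ← ih, Nat.cast_succ, ← add_assoc,
      Complex.digamma_apply_add_one, one_div]
    intro m hm
    have := congrArg Complex.re hm
    simp only [Complex.add_re, Complex.natCast_re, Complex.neg_re] at this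
    have h1 : (0 : ℝ) ≤ m := m.cast_nonneg
    have h2 : (0 : ℝ) ≤ n := n.cast_nonneg
    linarith

theorem tendsto_digamma_add_nat_sub_one_add_nat {x : ℝ} (hx : 0 < x) :
    Tendsto (fun n : ℕ => Complex.digamma (1 + n) - Complex.digamma (x + n)) atTop (𝓝 0) := by
  have hlog : Tendsto (fun n : ℕ => Real.log (1 + n) - Real.log (x + n)) atTop (𝓝 0) := by
    have h1 : Tendsto (fun n : ℕ => 1 + (1 - x) * (x + n)⁻¹) atTop (𝓝 (1 + (1 - x) * 0)) :=
      tendsto_const_nhds.add ((tendsto_inv_atTop_zero.comp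
        (tendsto_atTop_add_const_left _ x tendsto_natCast_atTop_atTop)).const_mul _)
    have h2 := (Real.continuousAt_log (by norm_num : (1 + (1 - x) * 0 : ℝ) ≠ 0)).tendsto.comp h1
    rw [mul_zero, add_zero, Real.log_one] at h2
    refine h2.congr fun n => ?_
    have : 0 < x + n := by positivity
    rw [Function.comp_apply, ← Real.log_div (by positivity) (by positivity)]
    congr 1
    field_simp
    ring
  have h := ((tendsto_logDeriv_Gamma_sub_log one_pos).sub
    (tendsto_logDeriv_Gamma_sub_log hx)).add hlog
  simp only [sub_zero, add_zero] at h
  have h' := (Complex.continuous_ofReal.tendsto 0).comp h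
  rw [Complex.ofReal_zero] at h'
  refine h'.congr fun n => ?_
  have e1 := digamma_ofReal (x := 1 + n) (by positivity)
  have e2 := digamma_ofReal (x := x + n) (by positivity)
  push_cast at e1 e2
  rw [e1, e2, Function.comp_apply]
  push_cast
  ring

/-! ### Series for digamma and its derivatives -/

theorem isOpen_half_lt_re : IsOpen {z : ℂ | 1 / 2 < z.re} :=
  isOpen_lt continuous_const Complex.continuous_re

theorem isPreconnected_half_lt_re : IsPreconnected {z : ℂ | 1 / 2 < z.re} :=
  (convex_halfSpace_re_gt _).isPreconnected

/-- The half-plane Re z > 1/2 contains 1 and every 1 + u with u > 0, and its terms have a majorant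
independent of z. -/
theorem norm_one_div_add_nat_pow_le {z : ℂ} (hz : 1 / 2 < z.re) (m k : ℕ) :
    ‖1 / (z + k) ^ m‖ ≤ 1 / (k + 1 / 2 : ℝ) ^ m := by
  rw [norm_div, norm_one, norm_pow]
  gcongr
  calc (k + 1 / 2 : ℝ) ≤ (z + k).re := by simp; linarith
    _ ≤ ‖z + k‖ := Complex.re_le_norm _

theorem add_nat_ne_zero_of_half_lt_re {z : ℂ} (hz : 1 / 2 < z.re) (k : ℕ) : z + k ≠ 0 := by
  intro h
  have := congrArg Complex.re h
  simp only [Complex.add_re, Complex.natCast_re, Complex.zero_re] at this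
  have h2 : (0 : ℝ) ≤ k := k.cast_nonneg
  linarith

theorem summable_one_div_nat_add_half_pow (m : ℕ) :
    Summable fun k : ℕ => 1 / (k + 1 / 2 : ℝ) ^ (m + 2) := by
  have h := (Real.summable_one_div_nat_add_rpow (1 / 2) (m + 2 : ℕ)).2 (by push_cast; linarith [(m.cast_nonneg : (0:ℝ) ≤ m)])
  refine h.congr fun k => ?_
  rw [abs_of_pos (by positivity), Real.rpow_natCast]

theorem hasDerivAt_one_div_add_nat_pow {z : ℂ} (hz : 1 / 2 < z.re) (m k : ℕ) :
    HasDerivAt (fun z : ℂ => 1 / (z + k) ^ m) (-m * (1 / (z + k) ^ (m + 1))) z := by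
  have h0 := add_nat_ne_zero_of_half_lt_re hz k
  have h := (((hasDerivAt_id z).add_const (k : ℂ)).pow m).inv (pow_ne_zero m h0)
  simp only [id] at h
  simp only [one_div]
  refine (h.congr_deriv ?_)
  rcases m with _ | m
  · simp
  · simp only [Pi.pow_apply, Nat.add_sub_cancel]
    field_simp
    ring

theorem hasDerivAt_tsum_one_div_add_nat_pow {z : ℂ} (hz : 1 / 2 < z.re) (m : ℕ) :
    HasDerivAt (fun z : ℂ => ∑' k : ℕ, 1 / (z + k) ^ (m + 2))
      (-(m + 2 : ℕ) * ∑' k : ℕ, 1 / (z + k) ^ (m + 3)) z := by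
  rw [← tsum_mul_left]
  refine hasDerivAt_tsum_of_isPreconnected
    ((summable_one_div_nat_add_half_pow (m + 1)).mul_left ((m + 2 : ℕ) : ℝ))
    isOpen_half_lt_re isPreconnected_half_lt_re
    (fun k y hy => hasDerivAt_one_div_add_nat_pow hy (m + 2) k) (fun k y hy => ?_) hz
    (.of_norm_bounded (summable_one_div_nat_add_half_pow m)
      fun k => norm_one_div_add_nat_pow_le hz (m + 2) k) hz
  rw [norm_mul, norm_neg, Complex.norm_natCast]
  gcongr
  exact norm_one_div_add_nat_pow_le hy (m + 3) k

theorem hasDerivAt_tsum_one_sub_one_div_add_nat {z : ℂ} (hz : 1 / 2 < z.re) :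
    HasDerivAt (fun z : ℂ => ∑' k : ℕ, (1 / (1 + (k : ℂ)) - 1 / (z + k)))
      (∑' k : ℕ, 1 / (z + k) ^ 2) z := by
  -- At the base point 1 every term vanishes, so convergence there is trivial.
  refine hasDerivAt_tsum_of_isPreconnected (summable_one_div_nat_add_half_pow 0)
    isOpen_half_lt_re isPreconnected_half_lt_re (fun k y hy => ?_)
    (fun k y hy => norm_one_div_add_nat_pow_le hy 2 k) (y₀ := 1) (by norm_num) ?_ hz
  · have h := (hasDerivAt_one_div_add_nat_pow hy 1 k).const_sub (1 / (1 + (k : ℂ)))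
    simpa using h
  · simp

theorem summable_one_sub_one_div_add_nat {x : ℝ} (hx : 0 < x) :
    Summable fun k : ℕ => (1 / (1 + (k : ℂ)) - 1 / ((x : ℂ) + k)) := by
  have h1 : Summable fun k : ℕ => (max 1 (1 / x)) * |x - 1| * (1 / ((k : ℝ) + 1) ^ 2) := by
    refine Summable.mul_left _ ?_
    exact_mod_cast (summable_nat_add_iff 1).2 (Real.summable_one_div_nat_pow.2 one_lt_two)
  refine .of_norm_bounded h1 fun k => ?_
  have e : (1 / (1 + (k : ℂ)) - 1 / ((x : ℂ) + k)) = (((x - 1) / ((1 + k) * (x + k)) : ℝ) : ℂ) := by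
    have h1 : (1 + (k : ℂ)) ≠ 0 := by exact_mod_cast (by positivity : (1 + (k : ℝ)) ≠ 0)
    have h2 : (x + (k : ℂ)) ≠ 0 := by exact_mod_cast (by positivity : (x + (k : ℝ)) ≠ 0)
    push_cast
    field_simp
    ring
  rw [e, Complex.norm_real, Real.norm_eq_abs, abs_div,
    abs_of_pos (by positivity : 0 < (1 + (k : ℝ)) * (x + k))]
  -- The maximum covers both x ≥ 1 and x < 1.
  have h3 : (1 + k : ℝ) ≤ max 1 (1 / x) * (x + k) := by
    have hk : (0 : ℝ) ≤ k := k.cast_nonneg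
    have ha : 1 ≤ max 1 (1 / x) * x := by
      calc 1 = 1 / x * x := by field_simp
        _ ≤ _ := by gcongr; exact le_max_right _ _
    have hb : (k : ℝ) ≤ max 1 (1 / x) * k := le_mul_of_one_le_left hk (le_max_left _ _)
    linarith
  rw [mul_one_div, div_le_div_iff₀ (by positivity) (by positivity)]
  calc |x - 1| * ((k : ℝ) + 1) ^ 2 = |x - 1| * (1 + k) * (1 + k) := by ring
    _ ≤ |x - 1| * (1 + k) * (max 1 (1 / x) * (x + k)) := by gcongr
    _ = _ := by ring

theorem digamma_ofReal_sub_digamma_one {x : ℝ} (hx : 0 < x) :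
    Complex.digamma x - Complex.digamma 1 = ∑' k : ℕ, (1 / (1 + (k : ℂ)) - 1 / ((x : ℂ) + k)) := by
  refine tendsto_nhds_unique ?_ (summable_one_sub_one_div_add_nat hx).hasSum.tendsto_sum_nat
  have h := (tendsto_digamma_add_nat_sub_one_add_nat hx).add_const
    (Complex.digamma x - Complex.digamma 1)
  rw [zero_add] at h
  refine h.congr fun n => ?_
  rw [digamma_add_nat (by simp), digamma_add_nat (by simpa), Finset.sum_sub_distrib]
  ring

theorem differentiableAt_Gamma_of_re_pos {z : ℂ} (hz : 0 < z.re) :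
    DifferentiableAt ℂ Complex.Gamma z :=
  Complex.differentiableAt_Gamma z fun m h => by
    have := congrArg Complex.re h
    simp only [Complex.natCast_re, Complex.neg_re] at this
    have h2 : (0 : ℝ) ≤ m := m.cast_nonneg
    linarith

theorem analyticAt_Gamma_of_re_pos {z : ℂ} (hz : 0 < z.re) : AnalyticAt ℂ Complex.Gamma z := by
  have ho : IsOpen {z : ℂ | 0 < z.re} := isOpen_lt continuous_const Complex.continuous_re
  exact DifferentiableOn.analyticAt (s := {z : ℂ | 0 < z.re})
    (fun w hw => (differentiableAt_Gamma_of_re_pos hw).differentiableWithinAt) (ho.mem_nhds hz)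

theorem analyticAt_digamma_of_re_pos {z : ℂ} (hz : 0 < z.re) :
    AnalyticAt ℂ Complex.digamma z :=
  (analyticAt_Gamma_of_re_pos hz).deriv.div (analyticAt_Gamma_of_re_pos hz)
    (Complex.Gamma_ne_zero_of_re_pos hz)

theorem digamma_sub_digamma_one {z : ℂ} (hz : 1 / 2 < z.re) :
    Complex.digamma z - Complex.digamma 1 = ∑' k : ℕ, (1 / (1 + (k : ℂ)) - 1 / (z + k)) := by
  have h1 : AnalyticOnNhd ℂ (fun z => Complex.digamma z - Complex.digamma 1)
      {z : ℂ | 1 / 2 < z.re} := fun w hw =>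
    (analyticAt_digamma_of_re_pos (by simp only [mem_ofPred_eq] at hw; linarith)).sub
      analyticAt_const
  have h2 : AnalyticOnNhd ℂ (fun z : ℂ => ∑' k : ℕ, (1 / (1 + (k : ℂ)) - 1 / (z + k)))
      {z : ℂ | 1 / 2 < z.re} := DifferentiableOn.analyticOnNhd
    (fun w hw => (hasDerivAt_tsum_one_sub_one_div_add_nat hw).differentiableAt.differentiableWithinAt)
    isOpen_half_lt_re
  refine h1.eqOn_of_preconnected_of_frequently_eq h2 isPreconnected_half_lt_re (z₀ := 1)
    (by norm_num) ?_ hz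
  -- Agreement at real points accumulating at 1 suffices for the identity theorem.
  have ht : Tendsto (fun n : ℕ => ((1 + 1 / ((n : ℝ) + 1) : ℝ) : ℂ)) atTop (𝓝[≠] 1) := by
    refine tendsto_nhdsWithin_iff.2 ⟨?_, .of_forall fun n => ?_⟩
    · have h := (tendsto_one_div_add_atTop_nhds_zero_nat (𝕜 := ℝ)).const_add 1
      rw [add_zero] at h
      exact_mod_cast (Complex.continuous_ofReal.tendsto _).comp h
    · have : 0 < 1 / ((n : ℝ) + 1) := by positivity
      simp only [mem_compl_iff, mem_singleton_iff]
      intro h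
      rw [← Complex.ofReal_one, Complex.ofReal_inj] at h
      linarith
  exact ht.frequently (.of_forall fun n => digamma_ofReal_sub_digamma_one (by positivity))

theorem deriv_digamma {z : ℂ} (hz : 1 / 2 < z.re) :
    deriv Complex.digamma z = ∑' k : ℕ, 1 / (z + k) ^ 2 := by
  have h := (hasDerivAt_tsum_one_sub_one_div_add_nat hz).congr_of_eventuallyEq
    (isOpen_half_lt_re.eventually_mem hz |>.mono fun w hw => digamma_sub_digamma_one hw)
  rw [← h.deriv, deriv_sub_const]

theorem iteratedDeriv_digamma (m : ℕ) {z : ℂ} (hz : 1 / 2 < z.re) :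
    iteratedDeriv (m + 1) Complex.digamma z =
      (-1) ^ m * ((m + 1).factorial : ℂ) * ∑' k : ℕ, 1 / (z + k) ^ (m + 2) := by
  induction m generalizing z with
  | zero => simp [iteratedDeriv_one, deriv_digamma hz]
  | succ m ih =>
    rw [iteratedDeriv_succ, Filter.EventuallyEq.deriv_eq
      (isOpen_half_lt_re.eventually_mem hz |>.mono fun w hw => ih hw),
      ((hasDerivAt_tsum_one_div_add_nat_pow hz m).const_mul _).deriv,
      Nat.factorial_succ (m + 1)]
    push_cast
    ring

theorem iteratedDeriv_digamma_one (m : ℕ) :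
    iteratedDeriv (m + 1) Complex.digamma 1 =
      (-1) ^ m * ((m + 1).factorial : ℂ) * riemannZeta (m + 2 : ℕ) := by
  rw [iteratedDeriv_digamma m (by norm_num), zeta_eq_tsum_one_div_nat_add_one_cpow]
  · simp only [Complex.cpow_natCast, add_comm (1 : ℂ)]
  · simp only [Complex.natCast_re]
    push_cast
    linarith [(m.cast_nonneg : (0:ℝ) ≤ m)]

/-! ### Decay of the kernel and analyticity of its Mellin transform -/

theorem half_lt_re_one_add {u : ℝ} (hu : 0 < u) : 1 / 2 < (1 + (u : ℂ)).re := by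
  simp
  linarith

/-- A telescoping series. -/
theorem hasSum_one_div_mul_succ {a : ℝ} (ha : 0 < a) :
    HasSum (fun k : ℕ => 1 / ((a + k) * (a + k + 1))) (1 / a) := by
  rw [hasSum_iff_tendsto_nat_of_nonneg fun k => by positivity]
  have h : ∀ n : ℕ, ∑ k ∈ Finset.range n, 1 / ((a + k) * (a + k + 1)) = 1 / a - 1 / (a + n) := by
    intro n
    induction n with
    | zero => simp
    | succ n ih =>
      rw [Finset.sum_range_succ, ih]
      push_cast
      field_simp
      ring
  simp only [h]
  have ht : Tendsto (fun n : ℕ => 1 / (a + n)) atTop (𝓝 0) := by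
    simp only [one_div]
    exact tendsto_inv_atTop_zero.comp
      (tendsto_atTop_add_const_left _ a tendsto_natCast_atTop_atTop)
  simpa using ht.const_sub (1 / a)

theorem summable_one_div_one_add_add_nat_sq {u : ℝ} (hu : 0 < u) :
    Summable fun k : ℕ => 1 / (1 + u + k) ^ 2 := by
  refine .of_nonneg_of_le (fun k => by positivity) (fun k => ?_)
    (summable_one_div_nat_add_half_pow 0)
  exact one_div_le_one_div_of_le (by positivity)
    (pow_le_pow_left₀ (by positivity) (by linarith) 2)

theorem trigammaKernel_eq_ofReal {u : ℝ} (hu : 0 < u) :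
    trigammaKernel u = ((∑' k : ℕ, 1 / (1 + u + k) ^ 2 - 1 / (1 + u) : ℝ) : ℂ) := by
  rw [trigammaKernel, deriv_digamma (half_lt_re_one_add hu)]
  push_cast
  rfl

theorem norm_trigammaKernel_le {u : ℝ} (hu : 0 < u) : ‖trigammaKernel u‖ ≤ 1 / (1 + u) ^ 2 := by
  have ha : 0 < 1 + u := by linarith
  -- Expanding 1/(1+u) as a telescoping series makes the kernel a series of positive terms, each at
  -- most 1/(1+u) times the telescoping term.
  have h1 := hasSum_one_div_mul_succ ha
  have h2 := (summable_one_div_one_add_add_nat_sq hu).hasSum.sub h1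
  have e (k : ℕ) : 1 / (1 + u + k) ^ 2 - 1 / ((1 + u + k) * (1 + u + k + 1)) =
      1 / ((1 + u + k) ^ 2 * (1 + u + k + 1)) := by
    field_simp
    ring
  simp only [e] at h2
  have h3 := h1.mul_left (1 / (1 + u))
  rw [trigammaKernel_eq_ofReal hu, Complex.norm_real, Real.norm_eq_abs,
    abs_of_nonneg (h2.nonneg fun k => by positivity)]
  refine (hasSum_le (fun k => ?_) h2 h3).trans_eq (by field_simp)
  rw [one_div_mul_one_div]
  refine one_div_le_one_div_of_le (by positivity) ?_
  calc (1 + u) * ((1 + u + k) * (1 + u + k + 1))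
      ≤ (1 + u + k) * ((1 + u + k) * (1 + u + k + 1)) :=
        mul_le_mul_of_nonneg_right (by linarith [(k.cast_nonneg : (0 : ℝ) ≤ k)]) (by positivity)
    _ = (1 + u + k) ^ 2 * (1 + u + k + 1) := by ring

theorem continuousOn_deriv_digamma_one_add :
    ContinuousOn (fun u : ℝ => deriv Complex.digamma (1 + u)) (Ioi 0) := by
  intro u hu
  have h := (analyticAt_digamma_of_re_pos (z := 1 + u)
    (by linarith [half_lt_re_one_add hu])).deriv.continuousAt
  exact (h.comp (f := fun u : ℝ => (1 + u : ℂ)) (by fun_prop)).continuousWithinAt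

theorem one_add_ofReal_ne_zero {u : ℝ} (hu : 0 < u) : (1 + u : ℂ) ≠ 0 := by
  exact_mod_cast (by linarith : 1 + u ≠ 0)

theorem continuousOn_trigammaKernel : ContinuousOn trigammaKernel (Ioi 0) :=
  continuousOn_deriv_digamma_one_add.sub <|
    ContinuousOn.div (by fun_prop) (by fun_prop) fun u hu => one_add_ofReal_ne_zero hu

theorem locallyIntegrableOn_log_pow_smul_trigammaKernel (m : ℕ) :
    LocallyIntegrableOn (fun u => Real.log u ^ m • trigammaKernel u) (Ioi 0) :=
  ContinuousOn.locallyIntegrableOn (((Real.continuousOn_log.mono fun _ hx => (mem_Ioi.1 hx).ne').pow m).smul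
    continuousOn_trigammaKernel) measurableSet_Ioi

/-- Each logarithm costs an arbitrarily small part of the exponent, hence the induction over all a <
2. -/
theorem log_pow_smul_trigammaKernel_isBigO_atTop (m : ℕ) {a : ℝ} (ha : a < 2) :
    (fun u => Real.log u ^ m • trigammaKernel u) =O[atTop] fun u => u ^ (-a) := by
  induction m generalizing a with
  | zero =>
    refine .of_bound 1 ?_
    filter_upwards [eventually_ge_atTop 1] with u hu
    have hu0 : 0 < u := by linarith
    simp only [pow_zero, one_smul, one_mul]
    rw [Real.norm_of_nonneg (by positivity)]
    calc ‖trigammaKernel u‖ ≤ 1 / (1 + u) ^ 2 := norm_trigammaKernel_le hu0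
      _ ≤ 1 / u ^ 2 := by gcongr; linarith
      _ = u ^ (-2 : ℝ) := by rw [Real.rpow_neg hu0.le, Real.rpow_two, one_div]
      _ ≤ u ^ (-a) := Real.rpow_le_rpow_of_exponent_le hu (by linarith)
  | succ m ih =>
    obtain ⟨b, hb, hb2⟩ := exists_between ha
    refine (isBigO_rpow_top_log_smul hb (ih hb2)).congr_left fun u => ?_
    rw [smul_smul, ← pow_succ']

theorem log_pow_smul_trigammaKernel_isBigO_zero (m : ℕ) {b : ℝ} (hb : 0 < b) :
    (fun u => Real.log u ^ m • trigammaKernel u) =O[𝓝[>] 0] fun u => u ^ (-b) := by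
  induction m generalizing b with
  | zero =>
    refine .of_bound 1 ?_
    filter_upwards [Ioo_mem_nhdsGT (one_pos : (0 : ℝ) < 1)] with u hu
    simp only [pow_zero, one_smul, one_mul]
    rw [Real.norm_of_nonneg (Real.rpow_nonneg hu.1.le _)]
    calc ‖trigammaKernel u‖ ≤ 1 / (1 + u) ^ 2 := norm_trigammaKernel_le hu.1
      _ ≤ 1 / 1 ^ 2 := by gcongr; linarith [hu.1]
      _ = 1 := by norm_num
      _ ≤ u ^ (-b) := Real.one_le_rpow_of_pos_of_le_one_of_nonpos hu.1 hu.2.le (by linarith)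
  | succ m ih =>
    obtain ⟨c, hc, hc2⟩ := exists_between hb
    refine (isBigO_rpow_zero_log_smul hc2 (ih hc)).congr_left fun u => ?_
    rw [smul_smul, ← pow_succ']

theorem mellinConvergent_log_pow_smul_trigammaKernel (m : ℕ) {z : ℂ} (h0 : 0 < z.re)
    (h2 : z.re < 2) : MellinConvergent (fun u => Real.log u ^ m • trigammaKernel u) z := by
  obtain ⟨a, ha, ha2⟩ := exists_between h2
  obtain ⟨b, hb, hb2⟩ := exists_between h0
  exact mellinConvergent_of_isBigO_rpow (locallyIntegrableOn_log_pow_smul_trigammaKernel m)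
    (log_pow_smul_trigammaKernel_isBigO_atTop m ha2) ha
    (log_pow_smul_trigammaKernel_isBigO_zero m hb) hb2

theorem hasDerivAt_mellin_log_pow_smul_trigammaKernel (m : ℕ) {z : ℂ} (h0 : 0 < z.re)
    (h2 : z.re < 2) : HasDerivAt (mellin fun u => Real.log u ^ m • trigammaKernel u)
      (mellin (fun u => Real.log u ^ (m + 1) • trigammaKernel u) z) z := by
  obtain ⟨a, ha, ha2⟩ := exists_between h2
  obtain ⟨b, hb, hb2⟩ := exists_between h0
  have h := (mellin_hasDerivAt_of_isBigO_rpow (locallyIntegrableOn_log_pow_smul_trigammaKernel m)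
    (log_pow_smul_trigammaKernel_isBigO_atTop m ha2) ha
    (log_pow_smul_trigammaKernel_isBigO_zero m hb) hb2).2
  simpa only [smul_smul, ← pow_succ'] using h

theorem isOpen_strip : IsOpen {z : ℂ | 0 < z.re ∧ z.re < 2} :=
  (isOpen_lt continuous_const Complex.continuous_re).inter
    (isOpen_lt Complex.continuous_re continuous_const)

theorem iteratedDeriv_mellin_trigammaKernel (m : ℕ) {z : ℂ} (h0 : 0 < z.re) (h2 : z.re < 2) :
    iteratedDeriv m (mellin trigammaKernel) z =
      mellin (fun u => Real.log u ^ m • trigammaKernel u) z := by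
  induction m generalizing z with
  | zero => simp
  | succ m ih =>
    rw [iteratedDeriv_succ, Filter.EventuallyEq.deriv_eq
      (isOpen_strip.eventually_mem ⟨h0, h2⟩ |>.mono fun w hw => ih hw.1 hw.2),
      (hasDerivAt_mellin_log_pow_smul_trigammaKernel m h0 h2).deriv]

theorem analyticOnNhd_mellin_trigammaKernel :
    AnalyticOnNhd ℂ (mellin trigammaKernel) {z : ℂ | 0 < z.re ∧ z.re < 2} := by
  refine DifferentiableOn.analyticOnNhd (fun z hz => ?_) isOpen_strip
  have h := hasDerivAt_mellin_log_pow_smul_trigammaKernel 0 hz.1 hz.2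
  simp only [pow_zero, one_smul] at h
  exact h.differentiableAt.differentiableWithinAt

/-! ### Evaluation of the Mellin transform -/

theorem image_div_one_sub_Ioo : (fun x : ℝ => x / (1 - x)) '' Ioo 0 1 = Ioi 0 := by
  ext y
  simp only [mem_image, mem_Ioo, mem_Ioi]
  constructor
  · rintro ⟨x, ⟨h0, h1⟩, rfl⟩
    exact div_pos h0 (by linarith)
  · intro hy
    refine ⟨y / (1 + y), ⟨by positivity, (div_lt_one (by positivity)).2 (by linarith)⟩, ?_⟩
    field_simp
    ring

/-- The Beta integral in the form of a Mellin transform. -/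
theorem hasMellin_one_add_inv_pow (n : ℕ) {a : ℂ} (h0 : 0 < a.re) (hn : a.re < n) :
    HasMellin (fun u : ℝ => 1 / (1 + (u : ℂ)) ^ n) a
      (Complex.Gamma a * Complex.Gamma (n - a) / Complex.Gamma n) := by
  have hb : 0 < ((n : ℂ) - a).re := by simpa
  have hd : ∀ x ∈ Ioo (0 : ℝ) 1,
      HasDerivWithinAt (fun x : ℝ => x / (1 - x)) (1 / (1 - x) ^ 2) (Ioo 0 1) x := by
    intro x hx
    have hx1 : 1 - x ≠ 0 := by linarith [hx.2]
    refine (((hasDerivAt_id x).div ((hasDerivAt_id x).const_sub 1) hx1).congr_deriv ?_).hasDerivWithinAt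
    simp
  have hinj : InjOn (fun x : ℝ => x / (1 - x)) (Ioo 0 1) := by
    intro x hx y hy hxy
    have hx1 : 1 - x ≠ 0 := by linarith [hx.2]
    have hy1 : 1 - y ≠ 0 := by linarith [hy.2]
    simp only at hxy
    rw [div_eq_div_iff hx1 hy1] at hxy
    linarith
  -- The substitution u = x/(1-x), where 1 + u = 1/(1-x), gives the Beta integrand.
  have e : ∀ x ∈ Ioo (0 : ℝ) 1, (x : ℂ) ^ (a - 1) * (1 - (x : ℂ)) ^ ((n : ℂ) - a - 1) =
      |1 / (1 - x) ^ 2| • (((x / (1 - x) : ℝ) : ℂ) ^ (a - 1) •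
        (1 / (1 + ((x / (1 - x) : ℝ) : ℂ)) ^ n)) := by
    intro x hx
    have hx1 : 0 < 1 - x := by linarith [hx.2]
    have hc : ((1 - x : ℝ) : ℂ) ≠ 0 := by exact_mod_cast hx1.ne'
    have h1 : (1 + ((x / (1 - x) : ℝ) : ℂ)) = ((1 - x : ℝ) : ℂ)⁻¹ := by
      push_cast at hc ⊢
      field_simp
      ring
    rw [abs_of_pos (by positivity), h1, Complex.ofReal_div,
      Complex.div_cpow_ofReal_nonneg hx.1.le hx1.le, Complex.real_smul, smul_eq_mul,
      inv_pow, one_div, one_div, inv_inv,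
      show 1 - (x : ℂ) = ((1 - x : ℝ) : ℂ) by push_cast; rfl]
    have h2 : ((1 - x : ℝ) : ℂ) ^ ((n : ℂ) - a - 1) =
        ((1 - x : ℝ) : ℂ) ^ n / (((1 - x : ℝ) : ℂ) ^ (a - 1) * ((1 - x : ℝ) : ℂ) ^ 2) := by
      rw [← Complex.cpow_natCast, ← Complex.cpow_natCast _ 2, ← Complex.cpow_add _ _ hc,
        ← Complex.cpow_sub _ _ hc]
      congr 1
      push_cast
      ring
    rw [h2, Complex.ofReal_inv, Complex.ofReal_pow]
    generalize ((1 - x : ℝ) : ℂ) = c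
    ring
  have hint : IntegrableOn (fun x : ℝ => (x : ℂ) ^ (a - 1) * (1 - (x : ℂ)) ^ ((n : ℂ) - a - 1))
      (Ioo 0 1) := by
    have := (Complex.betaIntegral_convergent h0 hb).1
    rwa [integrableOn_Ioc_iff_integrableOn_Ioo] at this
  constructor
  · rw [MellinConvergent, ← image_div_one_sub_Ioo,
      integrableOn_image_iff_integrableOn_abs_deriv_smul measurableSet_Ioo hd hinj]
    exact hint.congr_fun e measurableSet_Ioo
  · rw [mellin, ← image_div_one_sub_Ioo,
      integral_image_eq_integral_abs_deriv_smul measurableSet_Ioo hd hinj,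
      ← setIntegral_congr_fun measurableSet_Ioo e, ← integral_Ioc_eq_integral_Ioo,
      ← intervalIntegral.integral_of_le zero_le_one, eq_div_iff, mul_comm,
      Complex.Gamma_mul_Gamma_eq_betaIntegral h0 hb, Complex.betaIntegral, add_sub_cancel]
    refine Complex.Gamma_ne_zero_of_re_pos ?_
    simpa using h0.trans hn

theorem hasMellin_add_inv_sq {c : ℝ} (hc : 0 < c) {a : ℂ} (h0 : 0 < a.re) (h2 : a.re < 2) :
    HasMellin (fun u : ℝ => 1 / ((c : ℂ) + u) ^ 2) a
      ((c : ℂ) ^ (a - 2) * (Complex.Gamma a * Complex.Gamma (2 - a))) := by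
  have hc' : (c : ℂ) ≠ 0 := by exact_mod_cast hc.ne'
  have h := hasMellin_one_add_inv_pow 2 h0 (by simpa)
  have hG : Complex.Gamma ((2 : ℕ) : ℂ) = 1 := by
    simp
  rw [hG, div_one, Nat.cast_ofNat] at h
  have e : (fun u : ℝ => 1 / ((c : ℂ) + u) ^ 2) = fun u : ℝ => ((c : ℂ) ^ (-2 : ℂ)) •
      (fun u : ℝ => 1 / (1 + (u : ℂ)) ^ 2) (c⁻¹ * u) := by
    funext u
    have h1 : (c : ℂ) + u = c * (1 + ((c⁻¹ * u : ℝ) : ℂ)) := by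
      push_cast
      field_simp
    rw [h1, mul_pow, smul_eq_mul, Complex.cpow_neg, ← Nat.cast_ofNat (R := ℂ) (n := 2),
      Complex.cpow_natCast, ← one_div_mul_one_div, one_div ((c : ℂ) ^ 2)]
  rw [e]
  refine ⟨((MellinConvergent.comp_mul_left (inv_pos.2 hc)).2 h.1).const_smul _, ?_⟩
  rw [mellin_const_smul, mellin_comp_mul_left (fun u : ℝ => 1 / (1 + (u : ℂ)) ^ 2) _
    (inv_pos.2 hc), h.2, smul_eq_mul, smul_eq_mul,
    ← mul_assoc]
  congr 1
  rw [Complex.ofReal_inv, Complex.inv_cpow _ _ (by simp [Complex.arg_ofReal_of_nonneg hc.le, Real.pi_pos.ne]),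
    ← Complex.cpow_neg, neg_neg, ← Complex.cpow_add _ _ hc']
  congr 1
  ring

/-- The k-th term of the series scales to (k+1)^(a-2) times a Beta integral. The condition Re a < 1
makes these powers sum to ζ(2-a). -/
theorem hasMellin_deriv_digamma {a : ℂ} (h0 : 0 < a.re) (h1 : a.re < 1) :
    HasMellin (fun u : ℝ => deriv Complex.digamma (1 + u)) a
      (Complex.Gamma a * Complex.Gamma (2 - a) * riemannZeta (2 - a)) := by
  have hK := mellinConvergent_log_pow_smul_trigammaKernel 0 h0 (by linarith)
  have hB := hasMellin_one_add_inv_pow 1 h0 (by simpa)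
  simp only [pow_zero, one_smul, pow_one] at hK hB
  have hconv : MellinConvergent (fun u : ℝ => deriv Complex.digamma (1 + u)) a := by
    refine (hK.add hB.1).congr_fun (fun u hu => ?_) measurableSet_Ioi
    simp only [Pi.add_apply, trigammaKernel, smul_eq_mul]
    ring
  refine ⟨hconv, ?_⟩
  have hcast (k : ℕ) : (((k : ℝ) + 1 : ℝ) : ℂ) = (k : ℂ) + 1 := by push_cast; rfl
  have hM (k : ℕ) := hasMellin_add_inv_sq (c := (k : ℝ) + 1) (by positivity) h0
    (by linarith : a.re < 2)
  simp only [hcast] at hM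
  -- Each term is dominated by its own norm; since 1/(1+u+k)^2 > 0, the norms sum to the norm of the
  -- limit, integrable by `hconv`.
  have key := hasSum_integral_of_dominated_convergence (μ := volume.restrict (Ioi (0 : ℝ)))
    (F := fun (k : ℕ) (u : ℝ) => (u : ℂ) ^ (a - 1) • (1 / (((k : ℂ) + 1) + u) ^ 2))
    (f := fun u : ℝ => (u : ℂ) ^ (a - 1) • deriv Complex.digamma (1 + u))
    (fun k u => ‖(u : ℂ) ^ (a - 1)‖ * (1 / (1 + u + k) ^ 2))
    (fun k => (hM k).1.aestronglyMeasurable)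
    (fun k => (ae_restrict_mem measurableSet_Ioi).mono fun u hu => ?_)
    ((ae_restrict_mem measurableSet_Ioi).mono fun u hu =>
      (summable_one_div_one_add_add_nat_sq hu).mul_left _)
    (hconv.norm.congr ((ae_restrict_mem measurableSet_Ioi).mono fun u hu => ?_))
    ((ae_restrict_mem measurableSet_Ioi).mono fun u hu => ?_)
  · have e (k : ℕ) : ∫ u in Ioi (0 : ℝ), (u : ℂ) ^ (a - 1) • (1 / (((k : ℂ) + 1) + u) ^ 2) =
        Complex.Gamma a * Complex.Gamma (2 - a) * (1 / ((k : ℂ) + 1) ^ (2 - a)) := by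
      have h := (hM k).2
      rw [mellin] at h
      rw [h, mul_comm, ← neg_sub 2 a, Complex.cpow_neg, one_div]
    simp only [e] at key
    rw [mellin, ← key.tsum_eq, tsum_mul_left, zeta_eq_tsum_one_div_nat_add_one_cpow]
    simp only [Complex.sub_re, Complex.re_ofNat]
    linarith
  · have hu' : 0 < u := hu
    have : ((k : ℂ) + 1 + u) = ((1 + u + k : ℝ) : ℂ) := by push_cast; ring
    rw [norm_smul, this, ← Complex.ofReal_pow, norm_div, Complex.norm_real,
      Real.norm_of_nonneg (by positivity), norm_one]
  · have hu' : 0 < u := hu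
    have h := deriv_digamma (half_lt_re_one_add hu)
    have h' : deriv Complex.digamma (1 + u) = ((∑' k : ℕ, 1 / (1 + u + k) ^ 2 : ℝ) : ℂ) := by
      rw [h]
      push_cast
      rfl
    simp only
    rw [tsum_mul_left, norm_smul, h', Complex.norm_real,
      Real.norm_of_nonneg (tsum_nonneg fun k => by positivity)]
  · rw [deriv_digamma (half_lt_re_one_add hu)]
    refine HasSum.const_smul _ ?_
    have hs : Summable fun k : ℕ => 1 / (1 + (u : ℂ) + k) ^ 2 :=
      .of_norm_bounded (summable_one_div_nat_add_half_pow 0)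
        fun k => norm_one_div_add_nat_pow_le (half_lt_re_one_add hu) 2 k
    refine hs.hasSum.congr_fun fun k => ?_
    congr 2
    ring

theorem riemannZeta₀_of_ne_one {s : ℂ} (hs : s ≠ 1) :
    riemannZeta₀ s = riemannZeta s - 1 / (s - 1) := by
  simp [riemannZeta₀, hs]

theorem mellin_trigammaKernel_of_one_lt_re {s : ℂ} (h1 : 1 < s.re) (h2 : s.re < 2) :
    mellin trigammaKernel (2 - s) =
      Complex.Gamma s * Complex.Gamma (2 - s) * riemannZeta₀ s := by
  have ha : 0 < (2 - s).re := by simpa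
  have ha1 : (2 - s).re < 1 := by
    simp only [Complex.sub_re, Complex.re_ofNat]
    linarith
  have hs : s ≠ 1 := by
    rintro rfl
    simp at h1
  have hs' : s - 1 ≠ 0 := sub_ne_zero.2 hs
  have hA := hasMellin_deriv_digamma ha ha1
  have hB := hasMellin_one_add_inv_pow 1 ha (by simpa)
  rw [Nat.cast_one, Complex.Gamma_one, div_one] at hB
  simp only [pow_one] at hB
  have h := (hasMellin_sub hA.1 hB.1).2
  rw [hA.2, hB.2, show (1 : ℂ) - (2 - s) = s - 1 by ring, sub_sub_cancel] at h
  have hG := Complex.Gamma_add_one (s - 1) hs'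
  rw [sub_add_cancel] at hG
  rw [show trigammaKernel = fun u : ℝ => deriv Complex.digamma (1 + u) - 1 / (1 + (u : ℂ)) from rfl,
    h, riemannZeta₀_of_ne_one hs, hG]
  field_simp

theorem two_sub_mem_strip {s : ℂ} (h : s ∈ {z : ℂ | 0 < z.re ∧ z.re < 2}) :
    2 - s ∈ {z : ℂ | 0 < z.re ∧ z.re < 2} := by
  simp only [mem_ofPred_eq, Complex.sub_re, Complex.re_ofNat] at h ⊢
  constructor <;> linarith

/-- Both sides are analytic on the strip, and they agree near 3/2. -/
theorem mellin_trigammaKernel {s : ℂ} (h0 : 0 < s.re) (h2 : s.re < 2) :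
    mellin trigammaKernel (2 - s) =
      Complex.Gamma s * Complex.Gamma (2 - s) * riemannZeta₀ s := by
  have hM : AnalyticOnNhd ℂ (fun s => mellin trigammaKernel (2 - s))
      {z : ℂ | 0 < z.re ∧ z.re < 2} := fun z hz =>
    (analyticOnNhd_mellin_trigammaKernel _ (two_sub_mem_strip hz)).fun_comp
      (analyticAt_const.sub analyticAt_id)
  have hZ : AnalyticOnNhd ℂ (fun s => Complex.Gamma s * Complex.Gamma (2 - s) * riemannZeta₀ s)
      {z : ℂ | 0 < z.re ∧ z.re < 2} := fun z hz =>
    ((analyticAt_Gamma_of_re_pos hz.1).mul ((analyticAt_Gamma_of_re_pos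
      (two_sub_mem_strip hz).1).fun_comp (analyticAt_const.sub analyticAt_id))).mul
      (differentiable_riemannZeta₀.analyticAt z)
  have hconn : IsPreconnected {z : ℂ | 0 < z.re ∧ z.re < 2} :=
    ((convex_halfSpace_re_gt 0).inter (convex_halfSpace_re_lt 2)).isPreconnected
  refine hM.eqOn_of_preconnected_of_eventuallyEq hZ hconn (z₀ := 3 / 2) ⟨by norm_num, by norm_num⟩
    ?_ ⟨h0, h2⟩
  have ho : IsOpen {z : ℂ | 1 < z.re ∧ z.re < 2} :=
    (isOpen_lt continuous_const Complex.continuous_re).inter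
      (isOpen_lt Complex.continuous_re continuous_const)
  exact (ho.eventually_mem (x := 3 / 2) ⟨by norm_num, by norm_num⟩).mono fun w hw =>
    mellin_trigammaKernel_of_one_lt_re hw.1 hw.2

/-! ### Taylor coefficients at s = 1 -/

theorem iteratedDeriv_digamma_two_sub_sub_digamma (m : ℕ) :
    iteratedDeriv m (fun s => Complex.digamma (2 - s) - Complex.digamma s) 1 =
      bellArg 1 (m + 1) := by
  have h1 : AnalyticAt ℂ (fun s => Complex.digamma (2 - s)) 1 :=
    (analyticAt_digamma_of_re_pos (by norm_num)).fun_comp (analyticAt_const.sub analyticAt_id)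
  have h2 : AnalyticAt ℂ Complex.digamma 1 := analyticAt_digamma_of_re_pos (by norm_num)
  rw [iteratedDeriv_fun_sub h1.contDiffAt h2.contDiffAt, iteratedDeriv_comp_const_sub, bellArg,
    Nat.add_sub_cancel]
  simp only [smul_eq_mul]

theorem bellArg_one_one : bellArg 1 1 = 0 := by
  have : (2 - 1 : ℂ) = 1 := by norm_num
  simp [bellArg, this]

theorem bellArg_one_of_two_le {j : ℕ} (hj : 2 ≤ j) :
    bellArg 1 j = -(1 + (-1) ^ j) * riemannZeta j * ((j - 1).factorial : ℂ) := by
  obtain ⟨m, rfl⟩ := Nat.exists_eq_add_of_le' hj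
  have h : (2 - 1 : ℂ) = 1 := by norm_num
  have h' : ((-1 : ℂ) ^ m) * (-1) ^ m = 1 := by rw [← mul_pow]; simp
  rw [bellArg, h, show m + 2 - 1 = m + 1 by lia, iteratedDeriv_digamma_one, pow_succ, pow_add]
  linear_combination (-((m + 1).factorial : ℂ) * riemannZeta (m + 2 : ℕ)) * h'

/-- The function `1 / (Γ(s) Γ(2 - s))`, which is `sin(π s) / (π (1 - s))` for `s ≠ 1`. -/
noncomputable def invGammaMulGamma (s : ℂ) : ℂ := (Complex.Gamma s * Complex.Gamma (2 - s))⁻¹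

theorem analyticAt_invGammaMulGamma {s : ℂ} (hs : s ∈ {z : ℂ | 0 < z.re ∧ z.re < 2}) :
    AnalyticAt ℂ invGammaMulGamma s :=
  ((analyticAt_Gamma_of_re_pos hs.1).mul ((analyticAt_Gamma_of_re_pos
    (two_sub_mem_strip hs).1).fun_comp (analyticAt_const.sub analyticAt_id))).inv
    (mul_ne_zero (Complex.Gamma_ne_zero_of_re_pos hs.1)
      (Complex.Gamma_ne_zero_of_re_pos (two_sub_mem_strip hs).1))

theorem deriv_invGammaMulGamma {s : ℂ} (hs : s ∈ {z : ℂ | 0 < z.re ∧ z.re < 2}) :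
    deriv invGammaMulGamma s =
      invGammaMulGamma s * (Complex.digamma (2 - s) - Complex.digamma s) := by
  have hs' := (two_sub_mem_strip hs).1
  have h1 := Complex.Gamma_ne_zero_of_re_pos hs.1
  have h2 := Complex.Gamma_ne_zero_of_re_pos hs'
  have d1 := (differentiableAt_Gamma_of_re_pos hs.1).hasDerivAt
  have d2 := (differentiableAt_Gamma_of_re_pos hs').hasDerivAt.comp s
    ((hasDerivAt_id s).const_sub 2)
  have h := ((d1.mul d2).inv (mul_ne_zero h1 h2)).deriv
  refine h.trans ?_
  simp only [Pi.mul_apply, Function.comp_apply, invGammaMulGamma, Complex.digamma_def,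
    logDeriv_apply]
  field_simp
  ring

/-- Leibniz' rule applied to g' = g·(ψ(2-s) - ψ(s)) reproduces `completeBell_succ`, with g(1) = 1.
-/
theorem iteratedDeriv_invGammaMulGamma_one (n : ℕ) :
    iteratedDeriv n invGammaMulGamma 1 = completeBell n (bellArg 1) := by
  have hmem : (1 : ℂ) ∈ {z : ℂ | 0 < z.re ∧ z.re < 2} := ⟨by norm_num, by norm_num⟩
  induction n using Nat.strong_induction_on with
  | _ n ih =>
    rcases n with _ | n
    · have : (2 - 1 : ℂ) = 1 := by norm_num
      simp [invGammaMulGamma, this]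
    · have h1 : AnalyticAt ℂ (fun s => Complex.digamma (2 - s) - Complex.digamma s) 1 :=
        ((analyticAt_digamma_of_re_pos (by norm_num)).fun_comp
          (analyticAt_const.sub analyticAt_id)).sub (analyticAt_digamma_of_re_pos (by norm_num))
      rw [iteratedDeriv_succ', Filter.EventuallyEq.iteratedDeriv_eq n
        (isOpen_strip.eventually_mem hmem |>.mono fun w hw => deriv_invGammaMulGamma hw),
        iteratedDeriv_fun_mul (analyticAt_invGammaMulGamma hmem).contDiffAt h1.contDiffAt,
        completeBell_succ]
      refine Finset.sum_congr rfl fun i hi => ?_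
      rw [iteratedDeriv_digamma_two_sub_sub_digamma, ih i (Finset.mem_range.1 hi)]

theorem riemannZeta₀_eq_invGammaMulGamma_mul {s : ℂ}
    (hs : s ∈ {z : ℂ | 0 < z.re ∧ z.re < 2}) :
    riemannZeta₀ s = invGammaMulGamma s * mellin trigammaKernel (2 - s) := by
  rw [mellin_trigammaKernel hs.1 hs.2, invGammaMulGamma, inv_mul_cancel_left₀]
  exact mul_ne_zero (Complex.Gamma_ne_zero_of_re_pos hs.1)
      (Complex.Gamma_ne_zero_of_re_pos (two_sub_mem_strip hs).1)

theorem invGammaMulGamma_of_ne_one {s : ℂ} (hs : s ≠ 1) :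
    invGammaMulGamma s = -(Complex.sin (Real.pi * s) / (Real.pi * (s - 1))) := by
  have h := Complex.Gamma_add_one (1 - s) (sub_ne_zero.2 hs.symm)
  rw [show 1 - s + 1 = 2 - s by ring] at h
  rw [invGammaMulGamma, h, mul_left_comm, Complex.Gamma_mul_Gamma_one_sub, mul_inv, inv_div,
    ← neg_sub s 1, inv_neg, mul_comm (Real.pi : ℂ) (s - 1), ← div_div, div_div, div_mul_eq_div_div]
  ring

theorem log_pow_smul_trigammaKernel_eq (m : ℕ) (u : ℝ) :
    (u : ℂ) ^ ((1 : ℂ) - 1) • Real.log u ^ m • trigammaKernel u =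
      trigammaKernel u * (Real.log u : ℂ) ^ m := by
  rw [sub_self, Complex.cpow_zero, one_smul, Complex.real_smul, Complex.ofReal_pow, mul_comm]

theorem integrableOn_trigammaKernel_mul_log_pow (m : ℕ) :
    IntegrableOn (fun u : ℝ => trigammaKernel u * (Real.log u : ℂ) ^ m) (Ioi 0) := by
  have h := mellinConvergent_log_pow_smul_trigammaKernel m (z := 1) (by norm_num) (by norm_num)
  simpa only [MellinConvergent, log_pow_smul_trigammaKernel_eq] using h

theorem iteratedDeriv_mellin_trigammaKernel_two_sub_one (m : ℕ) :
    iteratedDeriv m (fun s => mellin trigammaKernel (2 - s)) 1 =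
      (-1) ^ m * ∫ u in Ioi (0 : ℝ), trigammaKernel u * (Real.log u : ℂ) ^ m := by
  rw [iteratedDeriv_comp_const_sub]
  simp only [show (2 - 1 : ℂ) = 1 by norm_num]
  rw [iteratedDeriv_mellin_trigammaKernel m (by norm_num) (by norm_num), mellin, smul_eq_mul]
  simp only [log_pow_smul_trigammaKernel_eq]

theorem stieltjesConst_eq_sum_completeBell (n : ℕ) : stieltjesConst n =
    ∑ k ∈ Finset.range (n + 1), (n.choose k : ℂ) * (-1) ^ k * completeBell k (bellArg 1) *
      ∫ u in Ioi (0 : ℝ), trigammaKernel u * (Real.log u : ℂ) ^ (n - k) := by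
  have hmem : (1 : ℂ) ∈ {z : ℂ | 0 < z.re ∧ z.re < 2} := ⟨by norm_num, by norm_num⟩
  have hM : AnalyticAt ℂ (fun s => mellin trigammaKernel (2 - s)) 1 :=
    (analyticOnNhd_mellin_trigammaKernel _ (two_sub_mem_strip hmem)).fun_comp
      (analyticAt_const.sub analyticAt_id)
  rw [stieltjesConst, Filter.EventuallyEq.iteratedDeriv_eq n
    (isOpen_strip.eventually_mem hmem |>.mono fun w hw => riemannZeta₀_eq_invGammaMulGamma_mul hw),
    iteratedDeriv_fun_mul (analyticAt_invGammaMulGamma hmem).contDiffAt hM.contDiffAt,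
    Finset.mul_sum]
  refine Finset.sum_congr rfl fun k hk => ?_
  have hk' : k ≤ n := by
    rw [Finset.mem_range] at hk
    lia
  rw [iteratedDeriv_invGammaMulGamma_one, iteratedDeriv_mellin_trigammaKernel_two_sub_one]
  -- The sign (-1)^(n-k) from differentiating in 2 - s cancels part of (-1)^n, leaving (-1)^k.
  have h1 : (-1 : ℂ) ^ n = (-1) ^ k * (-1) ^ (n - k) := by rw [← pow_add, Nat.add_sub_cancel' hk']
  have h2 : ((-1 : ℂ) ^ (n - k)) * (-1) ^ (n - k) = 1 := by rw [← mul_pow]; simp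
  rw [h1]
  linear_combination ((-1 : ℂ) ^ k * (n.choose k : ℂ) * completeBell k (bellArg 1) *
    ∫ u in Ioi (0 : ℝ), trigammaKernel u * (Real.log u : ℂ) ^ (n - k)) * h2

theorem mellin_trigammaKernel_two_sub_integrand (s : ℂ) (u : ℝ) :
    (u : ℂ) ^ (2 - s - 1) • trigammaKernel u = trigammaKernel u * (u : ℂ) ^ (1 - s) := by
  rw [smul_eq_mul, mul_comm, show 2 - s - 1 = 1 - s by ring]

end Stieltjes

theorem mainTheorem5 :
    -- de Bruijn's formula, with convergence of its integral
    (∀ s : ℂ, 0 < s.re → s.re < 2 → s ≠ 1 →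
      MeasureTheory.IntegrableOn (fun u : ℝ => trigammaKernel u * (u : ℂ) ^ (1 - s))
        (Set.Ioi 0) ∧
      riemannZeta s = 1 / (s - 1) - Complex.sin (Real.pi * s) / (Real.pi * (s - 1)) *
        ∫ u in Set.Ioi (0 : ℝ), trigammaKernel u * (u : ℂ) ^ (1 - s)) ∧
    -- convergence of the logarithmic integrals
    (∀ m : ℕ, MeasureTheory.IntegrableOn
      (fun u : ℝ => trigammaKernel u * (Real.log u : ℂ) ^ m) (Set.Ioi 0)) ∧
    -- the Stieltjes constants as sums of the logarithmic integrals
    (∀ n : ℕ, stieltjesConst n =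
      ∑ k ∈ Finset.range (n + 1), (n.choose k : ℂ) * (-1) ^ k * completeBell k (bellArg 1) *
        ∫ u in Set.Ioi (0 : ℝ), trigammaKernel u * (Real.log u : ℂ) ^ (n - k)) ∧
    -- the Bell polynomial weights in terms of zeta values
    (∀ k : ℕ, completeBell k (bellArg 1) =
      completeBell k (fun j => if j = 1 then 0 else
        -(1 + (-1) ^ j) * riemannZeta j * ((j - 1).factorial : ℂ))) ∧
    -- the case `n = 1`
    stieltjesConst 1 =
      ∫ u in Set.Ioi (0 : ℝ), trigammaKernel u * (Real.log u : ℂ) := by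
  refine ⟨fun s h0 h2 hs => ⟨?_, ?_⟩, integrableOn_trigammaKernel_mul_log_pow,
    stieltjesConst_eq_sum_completeBell, fun k => completeBell_congr fun j h1 _ => ?_, ?_⟩
  · have hm := two_sub_mem_strip (s := s) ⟨h0, h2⟩
    have h := mellinConvergent_log_pow_smul_trigammaKernel 0 hm.1 hm.2
    simpa only [pow_zero, one_smul, MellinConvergent,
      mellin_trigammaKernel_two_sub_integrand] using h
  · have h := riemannZeta₀_eq_invGammaMulGamma_mul (s := s) ⟨h0, h2⟩
    rw [riemannZeta₀_of_ne_one hs, invGammaMulGamma_of_ne_one hs, mellin] at h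
    simp only [mellin_trigammaKernel_two_sub_integrand] at h
    linear_combination h
  · split_ifs with hj
    · rw [hj, bellArg_one_one]
    · exact bellArg_one_of_two_le (by lia)
  -- Y_1 = x_1 = 0, so only k = 0 survives.
  · have h1 : completeBell 1 (bellArg 1) = 0 := by
      simp [completeBell_succ, bellArg_one_one]
    simp [stieltjesConst_eq_sum_completeBell 1, Finset.sum_range_succ, h1]
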